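/- Let $M\ge 1$ and $m\ge 0$ be integers such that $\gcd(M,2m+2)=1$ if $m>0$. For $\tau,z_1,z_2,t\in\mathbb C$ with $\operatorname{Im}\tau>0$ and $z_1,z_2\notin\mathbb Z+\mathbb Z\tau$, write $q^x=e^{2\pi i\tau x}$ and let $$\Phi^{[m]}(\tau,z_1,z_2,t)=e^{2\pi i(m+1)t}\sum_{j\in\mathbb Z}\left(\frac{e^{2\pi ij(m+1)(z_1+z_2)}q^{j^2(m+1)}}{1-e^{2\pi iz_1}q^j}-\frac{e^{-2\pi ij(m+1)(z_1+z_2)}q^{j^2(m+1)}}{1-e^{-2\pi iz_2}q^j}\right)$$ (the numerator of the normalized supercharacter of the level-$m$ module $L(m\Lambda_0)$ over $\widehat{s\ell}_{2|1}$). For integers $n\ge1$ and $j$ let $$\Theta_{j,n}(\tau,z)=\sum_{x\in\mathbb Z+\frac{j}{2n}}q^{nx^2}e^{2\pi inxz},$$ $$R_{n;j}(\tau,v)=\sum_{\substack{l\in\mathbb Z\\ l\equiv j \bmod 2n}}\left(\operatorname{sign}\left(l+\tfrac12\right)-E\left(\left(l+2n\frac{\operatorname{Im}v}{\operatorname{Im}\tau}\right)\sqrt{\frac{\operatorname{Im}\tau}{n}}\right)\right)e^{-\frac{\pi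 il^2}{2n}\tau-2\pi ilv},\qquad E(x)=2\int_0^xe^{-\pi u^2}\,du .$$ Define the modified numerator $$\tilde\Phi^{[m]}(\tau,z_1,z_2,t)=\Phi^{[m]}(\tau,z_1,z_2,t)-\tfrac12e^{2\pi i(m+1)t}\sum_{j\in\mathbb Z/(2m+2)\mathbb Z}R_{m+1;j}\left(\tau,\tfrac{z_1-z_2}{2}\right)\bigl(\Theta_{j,m+1}-\Theta_{-j,m+1}\bigr)(\tau,z_1+z_2).$$ Then, for all such $\tau,z_1,z_2,t$: (a) $$\tilde\Phi^{[m]}\left(-\frac M\tau,\frac{z_1}\tau,\frac{z_2}\tau,t-\frac{z_1z_2}{\tau M}\right)=\frac\tau M\sum_{j,k\in\mathbb Z/M\mathbb Z}q^{\frac{(m+1)jk}{M}}e^{\frac{2\pi i(m+1)}{M}(kz_1+jz_2)}\tilde\Phi^{[m]}(M\tau,z_1+j\tau,z_2+k\tau,t);$$ (b) $$\tilde\Phi^{[m]}\left(\frac\tau M,\frac{z_1}M,\frac{z_2}M,t\right)=\sum_{j,k\in\mathbb Z/M\mathbb Z}q^{\frac{(m+1)jk}{M}}e^{\frac{2\pi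 i(m+1)}{M}(kz_1+jz_2)}\tilde\Phi^{[m]}(M\tau,z_1+j\tau,z_2+k\tau,t).$$ Here the sums over $\mathbb Z/M\mathbb Z$ are taken over arbitrary integer representatives of the pairs $(j,k)$; the value does not depend on the choice. -/

import Mathlib

open Complex

noncomputable section

namespace SL21

/-- `q ^ x = e^{2πi τ x}`, the convention for (possibly fractional) powers of `q = e^{2πiτ}`. -/
def qpow (τ x : ℂ) : ℂ := exp (2 * Real.pi * I * τ * x)

/-- The numerator `Φ^{[m]}(τ, z₁, z₂, t)` of the normalized supercharacter of the
`ŝl_{2|1}`-module `L(mΛ₀)`; the series converges absolutely for `Im τ > 0`, and its terms are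
defined when neither `z₁` nor `z₂` lies in `ℤ + ℤτ`. -/
def Phi (m : ℕ) (τ z₁ z₂ t : ℂ) : ℂ :=
  exp (2 * Real.pi * I * (m + 1) * t) *
    ∑' j : ℤ,
      (exp (2 * Real.pi * I * j * (m + 1) * (z₁ + z₂)) * qpow τ ((j : ℂ) ^ 2 * (m + 1)) /
          (1 - exp (2 * Real.pi * I * z₁) * qpow τ j) -
        exp (-(2 * Real.pi * I * j * (m + 1) * (z₁ + z₂))) * qpow τ ((j : ℂ) ^ 2 * (m + 1)) /
          (1 - exp (-(2 * Real.pi * I * z₂)) * qpow τ j))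

/-- The theta function `Θ_{j,k}(τ, z) = ∑_{x ∈ ℤ + j/(2k)} q^{k x²} e^{2πi k x z}` of degree
`k ≥ 1`. -/
def Theta (j : ℤ) (k : ℕ) (τ z : ℂ) : ℂ :=
  ∑' n : ℤ,
    qpow τ (k * ((n : ℂ) + j / (2 * k)) ^ 2) *
      exp (2 * Real.pi * I * k * ((n : ℂ) + j / (2 * k)) * z)

/-- `E(x) = 2 ∫₀ˣ e^{-πu²} du` on the real line. -/
def zwegersE (x : ℝ) : ℝ := 2 * ∫ u in (0 : ℝ)..x, Real.exp (-Real.pi * u ^ 2)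

/-- The term of index `n` of the series that defines `R_{m;j}(τ, v)`. -/
def zwegersRTerm (m : ℕ) (τ v : ℂ) (n : ℤ) : ℂ :=
  ((Real.sign ((n : ℝ) + 1 / 2) -
      zwegersE (((n : ℝ) + 2 * m * (v.im / τ.im)) * Real.sqrt (τ.im / m)) : ℝ) : ℂ) *
    exp (-(Real.pi * I * (n : ℂ) ^ 2 / (2 * m)) * τ - 2 * Real.pi * I * n * v)

/-- Zwegers' function `R_{m;j}(τ, v)`, for `m ≥ 1`: the sum over the integers
`n ≡ j mod 2m`, which are written as `n = j + 2mk` with `k ∈ ℤ`. -/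
def zwegersR (m : ℕ) (j : ℤ) (τ v : ℂ) : ℂ :=
  ∑' k : ℤ, zwegersRTerm m τ v (j + 2 * m * k)

/-- The correction `Φ^{[m]}_add`. Both `R_{m+1;j}` and `Θ_{j,m+1}` depend on `j` only
modulo `2m+2`, so the sum over `ℤ/(2m+2)ℤ` is taken over `0, …, 2m+1`. -/
def PhiAdd (m : ℕ) (τ z₁ z₂ t : ℂ) : ℂ :=
  -(1 / 2) * exp (2 * Real.pi * I * (m + 1) * t) *
    ∑ j ∈ Finset.range (2 * m + 2),
      zwegersR (m + 1) j τ ((z₁ - z₂) / 2) *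
        (Theta j (m + 1) τ (z₁ + z₂) - Theta (-(j : ℤ)) (m + 1) τ (z₁ + z₂))

/-- The modified numerator `Φ̃^{[m]} = Φ^{[m]} + Φ^{[m]}_add`. -/
def PhiTilde (m : ℕ) (τ z₁ z₂ t : ℂ) : ℂ :=
  Phi m τ z₁ z₂ t + PhiAdd m τ z₁ z₂ t

/-- The summand `q^{(m+1)jk/M} e^{2πi(m+1)(k z₁ + j z₂)/M} Φ̃^{[m]}(Mτ, z₁ + jτ, z₂ + kτ, t)`
attached to integers `j`, `k`. -/
def modSummand (M m : ℕ) (τ z₁ z₂ t : ℂ) (j k : ℤ) : ℂ :=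
  qpow τ ((m + 1) / M * j * k) * exp (2 * Real.pi * I * (m + 1) / M * (k * z₁ + j * z₂)) *
    PhiTilde m (M * τ) (z₁ + j * τ) (z₂ + k * τ) t

end SL21

end

noncomputable section

namespace SL21

/-! ### The error function -/

/-! Put N = m + 1. The correction turns Φ̃ into a sum over a whole lattice: by `PhiTilde_eq` it is
e^{2πiNt}·i/(2π) times two absolutely convergent series of the form ∑ (Gaussian · phase)/(z + ω), ω
∈ ℤτ + ℤ, one with z = z₁, w = N z₂ and one with z₁, z₂ exchanged. Modular transformations then only
change the lattice.

That formula is proved row by row, for ω = aτ + k with a fixed. The products R·Θ unfold into rows of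
error-function sums with the same factor q^{Na²}e^{2πiaN(z₁+z₂)} as the terms of Φ, and
`one_div_sub_tsum_errTerm` says that 1/(1 - e^{2πiZ}) minus half such a sum is i/(2π) times a
Gaussian sum of 1/(Z + k). This rests on Poisson summation.

For τ ↦ -1/τ the lattice is rescaled by 1/τ (`latticeSum_neg_one_div`). For (b), each summand on the
right runs over the rows in one class mod M, twisted by a character of k; summing over the
characters keeps M ∣ k, as N is prime to M, and what is left is the series of τ/M scaled by M
(`sum_twist_mul_latticeSum`). Finally (a) is (b) combined with the inversion at τ/M. -/

theorem hasDerivAt_zwegersE (x : ℝ) :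
    HasDerivAt zwegersE (2 * Real.exp (-Real.pi * x ^ 2)) x := by
  have hc : Continuous fun u : ℝ => Real.exp (-Real.pi * u ^ 2) := by fun_prop
  exact (intervalIntegral.integral_hasDerivAt_right (hc.intervalIntegrable 0 x)
    hc.stronglyMeasurable.stronglyMeasurableAtFilter hc.continuousAt).const_mul 2

theorem zwegersE_neg (x : ℝ) : zwegersE (-x) = -zwegersE x := by
  have h := intervalIntegral.integral_comp_neg (a := 0) (b := x)
    (fun u : ℝ => Real.exp (-Real.pi * u ^ 2))
  simp only [neg_sq, neg_zero] at h
  simp only [zwegersE]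
  rw [intervalIntegral.integral_symm, ← h]
  ring

theorem tendsto_zwegersE : Filter.Tendsto zwegersE Filter.atTop (nhds 1) := by
  have h := MeasureTheory.intervalIntegral_tendsto_integral_Ioi (μ := MeasureTheory.volume)
    (f := fun u : ℝ => Real.exp (-Real.pi * u ^ 2)) 0
    (integrable_exp_neg_mul_sq Real.pi_pos).integrableOn Filter.tendsto_id
  rw [integral_gaussian_Ioi, div_self Real.pi_ne_zero, Real.sqrt_one] at h
  have h2 := h.const_mul 2
  rw [mul_one_div_cancel two_ne_zero] at h2
  exact h2

theorem monotone_zwegersE : Monotone zwegersE :=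
  monotone_of_hasDerivAt_nonneg hasDerivAt_zwegersE fun x => by positivity

theorem zwegersE_le_one (x : ℝ) : zwegersE x ≤ 1 :=
  monotone_zwegersE.ge_of_tendsto tendsto_zwegersE x

/-- Shift the tail integral to start at 0, use (u + x)² ≥ u² + x², and let the upper limit T tend to
infinity. -/
theorem one_sub_zwegersE_le {x : ℝ} (hx : 0 ≤ x) :
    1 - zwegersE x ≤ Real.exp (-Real.pi * x ^ 2) := by
  have key : ∀ T : ℝ, 0 ≤ T →
      zwegersE (T + x) - zwegersE x ≤ Real.exp (-Real.pi * x ^ 2) * zwegersE T := by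
    intro T hT
    have hc : Continuous fun u : ℝ => Real.exp (-Real.pi * u ^ 2) := by fun_prop
    have hc' : Continuous fun u : ℝ => Real.exp (-Real.pi * (u + x) ^ 2) := by fun_prop
    have h1 : zwegersE (T + x) - zwegersE x =
        2 * ∫ u in (0 : ℝ)..T, Real.exp (-Real.pi * (u + x) ^ 2) := by
      rw [intervalIntegral.integral_comp_add_right (fun u : ℝ => Real.exp (-Real.pi * u ^ 2)) x,
        zero_add, zwegersE, zwegersE, ← mul_sub, intervalIntegral.integral_interval_sub_left
        (hc.intervalIntegrable _ _) (hc.intervalIntegrable _ _)]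
    have h2 : Real.exp (-Real.pi * x ^ 2) * zwegersE T =
        2 * ∫ u in (0 : ℝ)..T, Real.exp (-Real.pi * x ^ 2) * Real.exp (-Real.pi * u ^ 2) := by
      rw [intervalIntegral.integral_const_mul, zwegersE]
      ring
    rw [h1, h2]
    refine mul_le_mul_of_nonneg_left (intervalIntegral.integral_mono_on hT
      (hc'.intervalIntegrable _ _) ((hc.const_mul _).intervalIntegrable _ _) ?_) zero_le_two
    intro u hu
    rw [← Real.exp_add]
    refine Real.exp_le_exp.2 ?_
    have := mul_nonneg Real.pi_pos.le (mul_nonneg hu.1 hx)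
    nlinarith
  have hl : Filter.Tendsto (fun T : ℝ => zwegersE (T + x) - zwegersE x) Filter.atTop
      (nhds (1 - zwegersE x)) :=
    (tendsto_zwegersE.comp (Filter.tendsto_atTop_add_const_right _ x Filter.tendsto_id)).sub_const _
  have hr := tendsto_zwegersE.const_mul (Real.exp (-Real.pi * x ^ 2))
  rw [mul_one] at hr
  exact le_of_tendsto_of_tendsto hl hr
    ((Filter.eventually_ge_atTop 0).mono fun T hT => key T hT)

theorem abs_one_sub_zwegersE_le {x : ℝ} (hx : 0 ≤ x) :
    |1 - zwegersE x| ≤ Real.exp (-Real.pi * x ^ 2) := by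
  rw [abs_of_nonneg (sub_nonneg.2 (zwegersE_le_one x))]
  exact one_sub_zwegersE_le hx

theorem abs_zwegersE_le_one (x : ℝ) : |zwegersE x| ≤ 1 := by
  refine abs_le.2 ⟨?_, zwegersE_le_one x⟩
  have := zwegersE_le_one (-x)
  rw [zwegersE_neg] at this
  linarith

theorem sign_int_add_half_of_nonneg {b : ℤ} (hb : 0 ≤ b) : Real.sign ((b : ℝ) + 1 / 2) = 1 := by
  have : (0 : ℝ) ≤ b := by exact_mod_cast hb
  exact Real.sign_of_pos (by linarith)

theorem sign_int_add_half_of_neg {b : ℤ} (hb : b < 0) : Real.sign ((b : ℝ) + 1 / 2) = -1 := by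
  have : (b : ℝ) + 1 ≤ 0 := by exact_mod_cast hb
  exact Real.sign_of_neg (by linarith)

/-- If b and b - c have the same sign, the Gaussian tail bound applies. Otherwise b² - 2bc = 2b(b -
c) - b² ≤ 0, so the right side is at least 2. The exponent is linear in c, which makes the bound
locally uniform in c. -/
theorem abs_sign_sub_zwegersE_le (s c : ℝ) (hs : 0 < s) (b : ℤ) :
    |Real.sign ((b : ℝ) + 1 / 2) - zwegersE ((b - c) * s)| ≤
      2 * Real.exp (-Real.pi * s ^ 2 * (b ^ 2 - 2 * b * c)) := by
  have hp : 0 ≤ Real.pi * s ^ 2 := by positivity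
  have hgood : Real.exp (-Real.pi * ((b - c) * s) ^ 2) ≤
      2 * Real.exp (-Real.pi * s ^ 2 * (b ^ 2 - 2 * b * c)) := by
    have h1 : Real.exp (-Real.pi * ((b - c) * s) ^ 2) ≤
        Real.exp (-Real.pi * s ^ 2 * (b ^ 2 - 2 * b * c)) := by
      refine Real.exp_le_exp.2 ?_
      have := mul_nonneg hp (sq_nonneg c)
      nlinarith
    have := Real.exp_pos (-Real.pi * s ^ 2 * (b ^ 2 - 2 * b * c))
    linarith
  have hbad : (b : ℝ) * (b - c) ≤ 0 → |Real.sign ((b : ℝ) + 1 / 2)| ≤ 1 →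
      |Real.sign ((b : ℝ) + 1 / 2) - zwegersE ((b - c) * s)| ≤
      2 * Real.exp (-Real.pi * s ^ 2 * (b ^ 2 - 2 * b * c)) := by
    intro h h1
    have h2 : 1 ≤ Real.exp (-Real.pi * s ^ 2 * (b ^ 2 - 2 * b * c)) := by
      refine Real.one_le_exp ?_
      have h3 : 0 ≤ -((b : ℝ) ^ 2 - 2 * b * c) := by nlinarith [sq_nonneg (b : ℝ)]
      have := mul_nonneg hp h3
      linarith
    calc _ ≤ |Real.sign ((b : ℝ) + 1 / 2)| + |zwegersE ((b - c) * s)| := abs_sub _ _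
      _ ≤ 1 + 1 := add_le_add h1 (abs_zwegersE_le_one _)
      _ ≤ _ := by linarith
  rcases le_or_gt 0 b with hb | hb
  · have hb' : (0 : ℝ) ≤ b := by exact_mod_cast hb
    rcases le_or_gt c b with hc | hc
    · rw [sign_int_add_half_of_nonneg hb]
      exact (abs_one_sub_zwegersE_le (mul_nonneg (sub_nonneg.2 hc) hs.le)).trans hgood
    · refine hbad (mul_nonpos_of_nonneg_of_nonpos hb' (by linarith)) ?_
      rw [sign_int_add_half_of_nonneg hb, abs_one]
  · have hb' : (b : ℝ) ≤ 0 := by exact_mod_cast hb.le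
    rcases le_or_gt (b : ℝ) c with hc | hc
    · rw [sign_int_add_half_of_neg hb]
      have h := abs_one_sub_zwegersE_le (x := -((b - c) * s))
        (by nlinarith)
      rw [zwegersE_neg, neg_sq, ← abs_neg] at h
      refine le_trans (le_of_eq ?_) (h.trans hgood)
      congr 1
      ring
    · refine hbad (mul_nonpos_of_nonpos_of_nonneg hb' (by linarith)) ?_
      rw [sign_int_add_half_of_neg hb, abs_neg, abs_one]

/-! ### The error-function sum along a row of the lattice -/

/-- The term `(sign (b + 1/2) - E ((b - c) s)) e^{2πi b Z}`. -/
def errTerm (s c : ℝ) (Z : ℂ) (b : ℤ) : ℂ :=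
  ((Real.sign ((b : ℝ) + 1 / 2) - zwegersE ((b - c) * s) : ℝ) : ℂ) * exp (2 * Real.pi * I * b * Z)

/-- The Gaussian term `e^{2πi (Z + k) c - π (Z + k)² / s²}`. -/
def gaussTerm (s c : ℝ) (Z : ℂ) (k : ℤ) : ℂ :=
  exp (2 * Real.pi * I * (Z + k) * c - Real.pi * (Z + k) ^ 2 / s ^ 2)

theorem summable_exp_quadratic (S : ℝ) {T : ℝ} (hT : 0 < T) :
    Summable fun n : ℤ => Real.exp (-Real.pi * (T * n ^ 2 - 2 * S * |(n : ℝ)|)) := by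
  simpa using summable_pow_mul_jacobiTheta₂_term_bound S hT 0

theorem norm_exp_int_mul (Z : ℂ) (b : ℤ) :
    ‖exp (2 * Real.pi * I * b * Z)‖ = Real.exp (-(2 * Real.pi * b * Z.im)) := by
  rw [norm_exp]
  congr 1
  simp

theorem exp_quadratic_le (s c y C : ℝ) (b : ℤ) (hc : |c| ≤ C) :
    Real.exp (-Real.pi * s ^ 2 * (b ^ 2 - 2 * b * c)) * Real.exp (-(2 * Real.pi * b * y)) ≤
      Real.exp (-Real.pi * (s ^ 2 * b ^ 2 - 2 * (s ^ 2 * C + |y|) * |(b : ℝ)|)) := by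
  rw [← Real.exp_add]
  refine Real.exp_le_exp.2 ?_
  have h1 : (b : ℝ) * c ≤ |(b : ℝ)| * C := by
    calc (b : ℝ) * c ≤ |(b : ℝ) * c| := le_abs_self _
      _ = |(b : ℝ)| * |c| := abs_mul _ _
      _ ≤ _ := by gcongr
  have h2 : -((b : ℝ) * y) ≤ |(b : ℝ)| * |y| := by
    rw [← abs_mul]
    exact neg_le_abs _
  have h3 := mul_le_mul_of_nonneg_left h1 (by positivity : 0 ≤ Real.pi * s ^ 2)
  have h4 := mul_le_mul_of_nonneg_left h2 Real.pi_pos.le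
  nlinarith

theorem norm_errTerm_le {s : ℝ} (hs : 0 < s) (c : ℝ) (Z : ℂ) (b : ℤ) :
    ‖errTerm s c Z b‖ ≤
      2 * Real.exp (-Real.pi * (s ^ 2 * b ^ 2 - 2 * (s ^ 2 * |c| + |Z.im|) * |(b : ℝ)|)) := by
  rw [errTerm, norm_mul, norm_exp_int_mul, norm_real, Real.norm_eq_abs]
  calc _ ≤ 2 * Real.exp (-Real.pi * s ^ 2 * (b ^ 2 - 2 * b * c)) *
        Real.exp (-(2 * Real.pi * b * Z.im)) := by
        gcongr
        exact abs_sign_sub_zwegersE_le s c hs b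
    _ ≤ _ := by
        rw [mul_assoc]
        gcongr
        exact exp_quadratic_le s c Z.im |c| b le_rfl

theorem summable_errTerm {s : ℝ} (hs : 0 < s) (c : ℝ) (Z : ℂ) : Summable (errTerm s c Z) :=
  Summable.of_norm_bounded ((summable_exp_quadratic _ (by positivity)).mul_left 2)
    (norm_errTerm_le hs c Z)

theorem hasDerivAt_errTerm (s c : ℝ) (Z : ℂ) (b : ℤ) :
    HasDerivAt (fun c : ℝ => errTerm s c Z b)
      (((2 * s * Real.exp (-Real.pi * ((b - c) * s) ^ 2) : ℝ) : ℂ) *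
        exp (2 * Real.pi * I * b * Z)) c := by
  have h1 : HasDerivAt (fun c : ℝ => ((b : ℝ) - c) * s) (-s) c := by
    simpa using ((hasDerivAt_id c).const_sub (b : ℝ)).mul_const s
  have h2 := ((hasDerivAt_zwegersE (((b : ℝ) - c) * s)).comp c h1).const_sub
    (Real.sign ((b : ℝ) + 1 / 2))
  have h3 := h2.ofReal_comp.mul_const (exp (2 * Real.pi * I * b * Z))
  refine h3.congr_deriv ?_
  congr 2
  ring

theorem hasDerivAt_tsum_errTerm {s : ℝ} (hs : 0 < s) (c : ℝ) (Z : ℂ) :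
    HasDerivAt (fun c : ℝ => ∑' b, errTerm s c Z b)
      (∑' b : ℤ, ((2 * s * Real.exp (-Real.pi * ((b - c) * s) ^ 2) : ℝ) : ℂ) *
        exp (2 * Real.pi * I * b * Z)) c := by
  have hc : c ∈ Metric.ball c 1 := Metric.mem_ball_self one_pos
  refine hasDerivAt_tsum_of_isPreconnected (g := fun b c => errTerm s c Z b)
    (g' := fun (b : ℤ) (c : ℝ) => ((2 * s * Real.exp (-Real.pi * ((b - c) * s) ^ 2) : ℝ) : ℂ) *
        exp (2 * Real.pi * I * b * Z))
    ((summable_exp_quadratic (s ^ 2 * (|c| + 1) + |Z.im|) (by positivity : 0 < s ^ 2)).mul_left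
      (2 * s)) Metric.isOpen_ball (convex_ball c 1).isPreconnected
    (fun b y _ => hasDerivAt_errTerm s y Z b) ?_ hc (summable_errTerm hs c Z) hc
  intro b y hy
  have hy' : |y| ≤ |c| + 1 := by
    have h1 : |y - c| < 1 := by simpa [Real.dist_eq] using hy
    have h2 := abs_sub_abs_le_abs_sub y c
    linarith
  rw [norm_mul, norm_exp_int_mul, norm_real, Real.norm_eq_abs, abs_of_pos (by positivity),
    mul_assoc (2 * s)]
  gcongr
  refine le_trans ?_ (exp_quadratic_le s y Z.im (|c| + 1) b hy')
  refine mul_le_mul_of_nonneg_right (Real.exp_le_exp.2 ?_) (Real.exp_pos _).le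
  have : 0 ≤ Real.pi * s ^ 2 * y ^ 2 := by positivity
  nlinarith

theorem norm_gaussTerm (s c : ℝ) (Z : ℂ) (k : ℤ) :
    ‖gaussTerm s c Z k‖ = Real.exp (-(2 * Real.pi * Z.im * c) -
      Real.pi * ((Z.re + k) ^ 2 - Z.im ^ 2) / s ^ 2) := by
  rw [gaussTerm, norm_exp]
  congr 1
  have h1 : (2 * Real.pi * I * (Z + k) * c : ℂ).re = -(2 * Real.pi * Z.im * c) := by
    simp
  have h2 : (Real.pi * (Z + k) ^ 2 / s ^ 2 : ℂ).re =
      Real.pi * ((Z.re + k) ^ 2 - Z.im ^ 2) / s ^ 2 := by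
    rw [← ofReal_pow, div_ofReal_re, re_ofReal_mul]
    simp [sq]
  rw [sub_re, h1, h2]

theorem norm_gaussTerm_le {s : ℝ} (hs : 0 < s) {c C : ℝ} (hc : |c| ≤ C) (Z : ℂ) (k : ℤ) :
    ‖gaussTerm s c Z k‖ ≤ Real.exp (2 * Real.pi * |Z.im| * C + Real.pi * Z.im ^ 2 / s ^ 2) *
      Real.exp (-Real.pi * ((1 / s ^ 2) * k ^ 2 - 2 * (|Z.re| / s ^ 2) * |(k : ℝ)|)) := by
  rw [norm_gaussTerm, ← Real.exp_add]
  refine Real.exp_le_exp.2 ?_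
  have h1 : -(Z.im * c) ≤ |Z.im| * C := by
    calc -(Z.im * c) ≤ |Z.im * c| := neg_le_abs _
      _ = |Z.im| * |c| := abs_mul _ _
      _ ≤ _ := by gcongr
  have h2 : -(Z.re * k) ≤ |Z.re| * |(k : ℝ)| := by
    rw [← abs_mul]
    exact neg_le_abs _
  have h3 := mul_le_mul_of_nonneg_left h1 Real.pi_pos.le
  have h4 := mul_le_mul_of_nonneg_left h2 (by positivity : 0 ≤ Real.pi / s ^ 2)
  have h5 : 0 ≤ Real.pi / s ^ 2 * Z.re ^ 2 := by positivity
  have e1 : Real.pi * ((Z.re + k) ^ 2 - Z.im ^ 2) / s ^ 2 =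
    Real.pi / s ^ 2 * Z.re ^ 2 + 2 * (Real.pi / s ^ 2 * (Z.re * k)) + Real.pi / s ^ 2 * k ^ 2 -
      Real.pi * Z.im ^ 2 / s ^ 2 := by ring
  have e2 : -Real.pi * ((1 / s ^ 2) * k ^ 2 - 2 * (|Z.re| / s ^ 2) * |(k : ℝ)|) =
    -(Real.pi / s ^ 2 * k ^ 2) + 2 * (Real.pi / s ^ 2 * (|Z.re| * |(k : ℝ)|)) := by ring
  rw [e1, e2]
  linarith

theorem summable_div_of_eventually_one_le_norm {ι : Type*} {f g : ι → ℂ} (hf : Summable f)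
    (hg : ∀ᶠ i in Filter.cofinite, 1 ≤ ‖g i‖) : Summable fun i => f i / g i := by
  refine Summable.of_norm_bounded_eventually hf.norm (hg.mono fun i hi => ?_)
  rw [norm_div]
  exact div_le_self (norm_nonneg _) hi

theorem eventually_one_le_norm_add_int (Z : ℂ) :
    ∀ᶠ k : ℤ in Filter.cofinite, 1 ≤ ‖Z + k‖ := by
  have h : Filter.Tendsto (fun k : ℤ => ‖(k : ℂ)‖) Filter.cofinite Filter.atTop := by
    have := tendsto_norm_cocompact_atTop.comp Int.tendsto_coe_cofinite
    refine this.congr fun k => ?_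
    simp
  filter_upwards [h.eventually_ge_atTop (1 + ‖Z‖)] with k hk
  have := norm_sub_norm_le (k : ℂ) (-Z)
  rw [sub_neg_eq_add, norm_neg, add_comm (k : ℂ)] at this
  linarith

theorem summable_gaussTerm {s : ℝ} (hs : 0 < s) (c : ℝ) (Z : ℂ) : Summable (gaussTerm s c Z) :=
  Summable.of_norm_bounded ((summable_exp_quadratic _ (by positivity)).mul_left _)
    (norm_gaussTerm_le hs le_rfl Z)

theorem summable_gaussTerm_div {s : ℝ} (hs : 0 < s) (c : ℝ) (Z : ℂ) :
    Summable fun k : ℤ => gaussTerm s c Z k / (Z + k) :=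
  summable_div_of_eventually_one_le_norm (summable_gaussTerm hs c Z)
    (eventually_one_le_norm_add_int Z)

theorem hasDerivAt_tsum_gaussTerm_div {s : ℝ} (hs : 0 < s) (c : ℝ) {Z : ℂ}
    (hZ : ∀ k : ℤ, Z + k ≠ 0) :
    HasDerivAt (fun c : ℝ => ∑' k : ℤ, gaussTerm s c Z k / (Z + k))
      (∑' k : ℤ, 2 * Real.pi * I * gaussTerm s c Z k) c := by
  have hc : c ∈ Metric.ball c 1 := Metric.mem_ball_self one_pos
  refine hasDerivAt_tsum_of_isPreconnected (g := fun (k : ℤ) c => gaussTerm s c Z k / (Z + k))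
    (g' := fun (k : ℤ) c => 2 * Real.pi * I * gaussTerm s c Z k)
    (((summable_exp_quadratic (|Z.re| / s ^ 2) (by positivity : 0 < 1 / s ^ 2)).mul_left
      (Real.exp (2 * Real.pi * |Z.im| * (|c| + 1) + Real.pi * Z.im ^ 2 / s ^ 2))).mul_left
        (2 * Real.pi)) Metric.isOpen_ball (convex_ball c 1).isPreconnected ?_ ?_ hc
        (summable_gaussTerm_div hs c Z) hc
  · intro k y _
    have h1 : HasDerivAt (fun y : ℝ => 2 * Real.pi * I * (Z + k) * (y : ℂ) -
        Real.pi * (Z + k) ^ 2 / s ^ 2) (2 * Real.pi * I * (Z + k)) y := by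
      simpa using ((hasDerivAt_id y).ofReal_comp.const_mul (2 * Real.pi * I * (Z + k))).sub_const
        (Real.pi * (Z + k) ^ 2 / s ^ 2)
    have h2 := h1.cexp.div_const (Z + k)
    refine h2.congr_deriv ?_
    have h3 := hZ k
    simp only [gaussTerm]
    field_simp
  · intro k y hy
    have hy' : |y| ≤ |c| + 1 := by
      have h1 : |y - c| < 1 := by simpa [Real.dist_eq] using hy
      have h2 := abs_sub_abs_le_abs_sub y c
      linarith
    have h1 : ‖(2 * Real.pi * I : ℂ)‖ = 2 * Real.pi := by
      simp [abs_of_pos Real.pi_pos]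
    rw [norm_mul, h1]
    gcongr
    exact norm_gaussTerm_le hs hy' Z k

/-- Poisson summation, taken from the functional equation of `jacobiTheta₂` at modulus i s². It
matches the c-derivatives of the error-function sum and of the Gaussian sum of 1/(Z + k). -/
theorem tsum_gaussTerm {s : ℝ} (hs : 0 < s) (c : ℝ) (Z : ℂ) :
    ∑' k : ℤ, gaussTerm s c Z k =
      ∑' b : ℤ, ((s * Real.exp (-Real.pi * ((b - c) * s) ^ 2) : ℝ) : ℂ) *
        exp (2 * Real.pi * I * b * Z) := by
  have hs' : (s : ℂ) ≠ 0 := by exact_mod_cast hs.ne'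
  have h1 : ∑' b : ℤ, ((s * Real.exp (-Real.pi * ((b - c) * s) ^ 2) : ℝ) : ℂ) *
        exp (2 * Real.pi * I * b * Z) =
      s * exp (-Real.pi * s ^ 2 * c ^ 2) * jacobiTheta₂ (Z - I * s ^ 2 * c) (I * s ^ 2) := by
    rw [jacobiTheta₂, ← tsum_mul_left]
    refine tsum_congr fun b => ?_
    rw [jacobiTheta₂_term]
    push_cast
    rw [mul_assoc (s : ℂ), mul_assoc (s : ℂ), ← exp_add, ← exp_add]
    congr 2
    linear_combination (Real.pi * s ^ 2 * (2 * b * c - b ^ 2) : ℂ) * I_sq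
  have h2 : ∑' k : ℤ, gaussTerm s c Z k =
      exp (2 * Real.pi * I * Z * c - Real.pi * Z ^ 2 / s ^ 2) *
        jacobiTheta₂ (c + I * Z / s ^ 2) (I / s ^ 2) := by
    rw [jacobiTheta₂, ← tsum_mul_left]
    refine tsum_congr fun k => ?_
    rw [jacobiTheta₂_term, gaussTerm, ← exp_add]
    congr 1
    field_simp
    linear_combination (-(k * (2 * Z + k)) : ℂ) * I_sq
  -- The principal square root of s² is s because s > 0.
  have h3 : (-I * (I * s ^ 2) : ℂ) ^ (1 / 2 : ℂ) = s := by
    have : (-I * (I * s ^ 2) : ℂ) = (s : ℂ) ^ 2 := by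
      linear_combination (-(s : ℂ) ^ 2) * I_sq
    rw [this, one_div]
    exact sq_cpow_two_inv (by simpa using hs)
  rw [h1, h2, jacobiTheta₂_functional_equation (Z - I * s ^ 2 * c), h3,
    ← jacobiTheta₂_neg_left ((Z - I * s ^ 2 * c) / (I * s ^ 2))]
  have h4 : -((Z - I * s ^ 2 * c) / (I * s ^ 2)) = c + I * Z / s ^ 2 := by
    field_simp
    linear_combination (-Z) * I_sq
  have h5 : (-1 / (I * s ^ 2) : ℂ) = I / s ^ 2 := by
    field_simp
    linear_combination -I_sq
  have h6 : exp (2 * Real.pi * I * Z * c - Real.pi * Z ^ 2 / s ^ 2) =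
      exp (-Real.pi * s ^ 2 * c ^ 2) *
        exp (-Real.pi * I * (Z - I * s ^ 2 * c) ^ 2 / (I * s ^ 2)) := by
    rw [← exp_add]
    congr 1
    field_simp
    linear_combination (s ^ 4 * c ^ 2: ℂ) * I_sq
  rw [h4, h5, h6]
  field_simp

theorem summable_int_single (x : ℤ) (w : ℂ) : Summable fun b : ℤ => if b = x then w else 0 :=
  (hasSum_ite_eq x w).summable

/-- Shifting b by one preserves b - c and multiplies the exponential by e^{2πiZ}. The sign changes
only from b = -1 to b = 0, where the exponential is 1; this jump is the extra 2. -/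
theorem tsum_errTerm_add_one {s : ℝ} (hs : 0 < s) (c : ℝ) (Z : ℂ) :
    ∑' b, errTerm s (c + 1) Z b =
      exp (2 * Real.pi * I * Z) * ∑' b, errTerm s c Z b + 2 := by
  rw [← (Equiv.addRight (1 : ℤ)).tsum_eq (errTerm s (c + 1) Z)]
  have h : ∀ b : ℤ, errTerm s (c + 1) Z ((Equiv.addRight (1 : ℤ)) b) =
      exp (2 * Real.pi * I * Z) * errTerm s c Z b + if b = -1 then 2 else 0 := by
    intro b
    have he : exp (2 * Real.pi * I * ((b + 1 : ℤ) : ℂ) * Z) =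
        exp (2 * Real.pi * I * Z) * exp (2 * Real.pi * I * b * Z) := by
      rw [← exp_add]
      congr 1
      push_cast
      ring
    have hE : (((b + 1 : ℤ) : ℝ) - (c + 1)) * s = (b - c) * s := by
      push_cast
      ring
    rw [Equiv.coe_addRight, errTerm, errTerm, he, hE]
    split_ifs with hb
    · subst hb
      rw [sign_int_add_half_of_nonneg (by norm_num), sign_int_add_half_of_neg (by norm_num)]
      have : exp (2 * Real.pi * I * Z) * exp (2 * Real.pi * I * ((-1 : ℤ) : ℂ) * Z) = 1 := by
        rw [← exp_add, ← exp_zero]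
        congr 1
        push_cast
        ring
      push_cast at this ⊢
      linear_combination (2 : ℂ) * this
    · have : Real.sign (((b + 1 : ℤ) : ℝ) + 1 / 2) = Real.sign ((b : ℝ) + 1 / 2) := by
        rcases le_or_gt 0 b with h | h
        · rw [sign_int_add_half_of_nonneg h, sign_int_add_half_of_nonneg (by omega)]
        · rw [sign_int_add_half_of_neg h, sign_int_add_half_of_neg (by omega)]
      rw [this]
      ring
  simp_rw [h]
  rw [((summable_errTerm hs c Z).mul_left _).tsum_add (summable_int_single _ _), tsum_mul_left,
    tsum_ite_eq]

theorem tsum_gaussTerm_div_add_one (s c : ℝ) (Z : ℂ) :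
    ∑' k : ℤ, gaussTerm s (c + 1) Z k / (Z + k) =
      exp (2 * Real.pi * I * Z) * ∑' k : ℤ, gaussTerm s c Z k / (Z + k) := by
  rw [← tsum_mul_left]
  refine tsum_congr fun k => ?_
  rw [← mul_div_assoc, gaussTerm, gaussTerm, ← exp_add]
  congr 1
  rw [exp_eq_exp_iff_exists_int]
  exact ⟨k, by push_cast; ring⟩

theorem one_sub_exp_ne_zero {Z : ℂ} (hZ : ∀ k : ℤ, Z + k ≠ 0) :
    1 - exp (2 * Real.pi * I * Z) ≠ 0 := by
  intro h
  obtain ⟨k, hk⟩ := exp_eq_one_iff.1 (sub_eq_zero.1 h).symm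
  have : Z = k := mul_left_cancel₀ two_pi_I_ne_zero (by rw [hk]; ring)
  exact hZ (-k) (by rw [this]; push_cast; ring)

/-- The two sides of the identity have the same derivative in `c`, and both are multiplied by
`e^{2πi Z}` when `c` is replaced by `c + 1`. -/
theorem one_div_sub_tsum_errTerm {s : ℝ} (hs : 0 < s) (c : ℝ) {Z : ℂ} (hZ : ∀ k : ℤ, Z + k ≠ 0) :
    1 / (1 - exp (2 * Real.pi * I * Z)) - 1 / 2 * ∑' b, errTerm s c Z b =
      I / (2 * Real.pi) * ∑' k : ℤ, gaussTerm s c Z k / (Z + k) := by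
  have hX := one_sub_exp_ne_zero hZ
  set D : ℝ → ℂ := fun c => 1 / (1 - exp (2 * Real.pi * I * Z)) - 1 / 2 * ∑' b, errTerm s c Z b -
      I / (2 * Real.pi) * ∑' k : ℤ, gaussTerm s c Z k / (Z + k) with hD
  have hd : ∀ c, HasDerivAt D 0 c := by
    intro c
    have h := (((hasDerivAt_tsum_errTerm hs c Z).const_mul (1 / 2 : ℂ)).const_sub
      (1 / (1 - exp (2 * Real.pi * I * Z)))).sub
      ((hasDerivAt_tsum_gaussTerm_div hs c hZ).const_mul (I / (2 * Real.pi)))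
    refine h.congr_deriv ?_
    have h2 : ∑' b : ℤ, ((2 * s * Real.exp (-Real.pi * ((b - c) * s) ^ 2) : ℝ) : ℂ) *
        exp (2 * Real.pi * I * b * Z) = 2 * ∑' k : ℤ, gaussTerm s c Z k := by
      rw [tsum_gaussTerm hs, ← tsum_mul_left]
      refine tsum_congr fun b => ?_
      push_cast
      ring
    have hpi : (Real.pi : ℂ) ≠ 0 := by exact_mod_cast Real.pi_ne_zero
    rw [tsum_mul_left, h2]
    field_simp
    linear_combination (-∑' k : ℤ, gaussTerm s c Z k) * I_sq
  have hconst : D (c + 1) = D c :=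
    is_const_of_deriv_eq_zero (fun x => (hd x).differentiableAt) (fun x => (hd x).deriv) _ _
  -- With X = e^{2πiZ}, the jump 2 is absorbed by 1/(1 - X) - 1 = X/(1 - X).
  have hshift : D (c + 1) = exp (2 * Real.pi * I * Z) * D c := by
    simp only [hD]
    rw [tsum_errTerm_add_one hs, tsum_gaussTerm_div_add_one]
    field_simp
    ring
  have h0 : (1 - exp (2 * Real.pi * I * Z)) * D c = 0 := by
    linear_combination hshift - hconst
  exact sub_eq_zero.1 ((mul_eq_zero.1 h0).resolve_left hX)

theorem one_div_one_sub_exp_neg {Z : ℂ} (hZ : ∀ k : ℤ, Z + k ≠ 0) :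
    1 / (1 - exp (-(2 * Real.pi * I * Z))) = 1 - 1 / (1 - exp (2 * Real.pi * I * Z)) := by
  have hX := one_sub_exp_ne_zero hZ
  have h0 := exp_ne_zero (2 * Real.pi * I * Z)
  have hX' : exp (2 * Real.pi * I * Z) - 1 ≠ 0 := by
    rw [← neg_sub]
    exact neg_ne_zero.2 hX
  rw [exp_neg]
  field_simp
  ring

theorem neg_one_div_sub_tsum_errTerm {s : ℝ} (hs : 0 < s) (c : ℝ) {Z : ℂ}
    (hZ : ∀ k : ℤ, Z + k ≠ 0) :
    -(1 / (1 - exp (-(2 * Real.pi * I * Z)))) - 1 / 2 * ∑' b, errTerm s c Z b =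
      -1 + I / (2 * Real.pi) * ∑' k : ℤ, gaussTerm s c Z k / (Z + k) := by
  rw [one_div_one_sub_exp_neg hZ, ← one_div_sub_tsum_errTerm hs c hZ]
  ring

theorem tsum_gaussTerm_div_neg (s c : ℝ) (Z : ℂ) :
    ∑' k : ℤ, gaussTerm s (-c) (-Z) k / (-Z + k) = -∑' k : ℤ, gaussTerm s c Z k / (Z + k) := by
  rw [← (Equiv.neg ℤ).tsum_eq, ← tsum_neg]
  refine tsum_congr fun k => ?_
  have h1 : gaussTerm s (-c) (-Z) (Equiv.neg ℤ k) = gaussTerm s c Z k := by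
    simp only [gaussTerm, Equiv.neg_apply]
    congr 1
    push_cast
    ring
  have h2 : -Z + ((Equiv.neg ℤ k : ℤ) : ℂ) = -(Z + k) := by
    simp only [Equiv.neg_apply]
    push_cast
    ring
  rw [h1, h2, div_neg]

theorem one_div_add_tsum_errTerm_neg {s : ℝ} (hs : 0 < s) (c : ℝ) {Z : ℂ}
    (hZ : ∀ k : ℤ, Z + k ≠ 0) :
    1 / (1 - exp (2 * Real.pi * I * Z)) + 1 / 2 * ∑' b, errTerm s (-c) (-Z) b =
      1 + I / (2 * Real.pi) * ∑' k : ℤ, gaussTerm s c Z k / (Z + k) := by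
  have hZ' : ∀ k : ℤ, -Z + k ≠ 0 := fun k h => hZ (-k) (by
    push_cast
    linear_combination -h)
  have h := one_div_sub_tsum_errTerm hs (-c) hZ'
  rw [tsum_gaussTerm_div_neg, mul_neg, one_div_one_sub_exp_neg hZ] at h
  linear_combination -h

/-! ### Sums over residue classes -/

theorem exists_residue_bound (n : ℕ) [NeZero n] (G : ℤ → ℝ)
    (hG : ∀ l k : ℤ, G (l + n * k) = G l) : ∃ C, ∀ l, |G l| ≤ C := by
  refine ⟨∑ j ∈ Finset.range n, |G j|, fun l => ?_⟩
  have hn : (n : ℤ) ≠ 0 := by exact_mod_cast NeZero.ne n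
  have h1 : G l = G ((l % n).toNat : ℤ) := by
    rw [Int.toNat_of_nonneg (Int.emod_nonneg l hn), ← hG (l % n) (l / n), Int.emod_add_mul_ediv]
  rw [h1]
  refine Finset.single_le_sum (f := fun j : ℕ => |G j|) (fun j _ => abs_nonneg _) ?_
  have := Int.emod_lt_of_pos l (b := n) (by have := NeZero.pos n; omega)
  have := Int.emod_nonneg l hn
  rw [Finset.mem_range]
  omega

theorem tsum_int_eq_sum_residue (n : ℕ) [NeZero n] {f : ℤ → ℂ} (hf : Summable f) :
    ∑' l, f l = ∑ j ∈ Finset.range n, ∑' k : ℤ, f (j + n * k) := by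
  set e : Fin n × ℤ ≃ ℤ := (Equiv.prodComm (Fin n) ℤ).trans (Int.divModEquiv n).symm with he
  have hs : Summable fun p : Fin n × ℤ => f (e p) := (Equiv.summable_iff e).2 hf
  rw [← e.tsum_eq f, hs.tsum_prod, tsum_fintype, Finset.sum_range]
  refine Finset.sum_congr rfl fun j _ => tsum_congr fun k => ?_
  congr 1
  simp only [he, Equiv.trans_apply, Equiv.prodComm_apply, Prod.swap_prod_mk, Int.divModEquiv,
    Equiv.coe_fn_symm_mk]
  ring

/-- The ℓ¹ norm of the row `g l` depends only on l mod n, so it is bounded in l. -/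
theorem summable_mul_of_residue (n : ℕ) [NeZero n] {f : ℤ → ℂ} (hf : Summable f)
    {g : ℤ → ℤ → ℂ} (hg : ∀ l, Summable (g l))
    (hper : ∀ l k, ∃ e : ℤ, ∀ a, g (l + n * k) a = g l (a + e)) :
    Summable fun p : ℤ × ℤ => f p.1 * g p.1 p.2 := by
  obtain ⟨C, hC⟩ := exists_residue_bound n (fun l => ∑' a, ‖g l a‖) (by
    intro l k
    obtain ⟨e, he⟩ := hper l k
    simp_rw [he]
    exact (Equiv.addRight e).tsum_eq fun a => ‖g l a‖)
  refine Summable.of_norm ((summable_prod_of_nonneg fun p => norm_nonneg _).2 ⟨fun l => ?_, ?_⟩)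
  · exact ((hg l).mul_left (f l)).norm
  · simp_rw [norm_mul, tsum_mul_left]
    refine Summable.of_norm_bounded (hf.norm.mul_right C) fun l => ?_
    rw [norm_mul, norm_norm]
    exact mul_le_mul_of_nonneg_left (hC l) (norm_nonneg _)

/-- Unfolds ∑ R_j Θ_j over residues j into a double series over ℤ × ℤ, in which the sum over l can
be done inside each row a. -/
theorem sum_tsum_mul_tsum_residue (n : ℕ) [NeZero n] {f : ℤ → ℂ} (hf : Summable f)
    {g : ℤ → ℤ → ℂ} (hg : ∀ l, Summable (g l))
    (hper : ∀ l k, ∃ e : ℤ, ∀ a, g (l + n * k) a = g l (a + e)) :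
    ∑ j ∈ Finset.range n, (∑' k : ℤ, f (j + n * k)) * ∑' a, g j a =
      ∑' a, ∑' l, f l * g l a := by
  have hs := summable_mul_of_residue n hf hg hper
  rw [Summable.tsum_comm (f := fun l a => f l * g l a) hs,
    tsum_int_eq_sum_residue n (f := fun l => ∑' a, f l * g l a) hs.prod]
  refine Finset.sum_congr rfl fun j _ => ?_
  rw [← tsum_mul_right]
  refine tsum_congr fun k => ?_
  obtain ⟨e, he⟩ := hper j k
  simp_rw [he]
  rw [tsum_mul_left]
  exact congrArg _ ((Equiv.addRight e).tsum_eq (g j)).symm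

/-! ### The terms of the theta functions and of `R` -/

/-- The term of index `a` of the series that defines `Θ_{j,N}(τ, u)`. -/
def thetaTerm (N : ℕ) (τ u : ℂ) (j a : ℤ) : ℂ :=
  qpow τ (N * ((a : ℂ) + j / (2 * N)) ^ 2) *
    exp (2 * Real.pi * I * N * ((a : ℂ) + j / (2 * N)) * u)

theorem summable_thetaTerm {N : ℕ} (hN : 0 < N) {τ : ℂ} (hτ : 0 < τ.im) (u : ℂ) (j : ℤ) :
    Summable (thetaTerm N τ u j) := by
  have hN' : (N : ℂ) ≠ 0 := by exact_mod_cast hN.ne'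
  have him : 0 < (2 * N * τ : ℂ).im := by
    have : (2 * N * τ : ℂ).im = 2 * N * τ.im := by simp
    rw [this]
    positivity
  have h := ((summable_jacobiTheta₂_term_iff (j * τ + N * u) (2 * N * τ)).2 him).mul_left
    (exp (2 * Real.pi * I * (τ * j ^ 2 / (4 * N) + j * u / 2)))
  refine h.congr fun a => ?_
  rw [thetaTerm, qpow, jacobiTheta₂_term, ← exp_add, ← exp_add]
  congr 1
  field_simp
  ring

theorem thetaTerm_add_mul {N : ℕ} (hN : 0 < N) (τ u : ℂ) (j k a : ℤ) :
    thetaTerm N τ u (j + (2 * N : ℕ) * k) a = thetaTerm N τ u j (a + k) := by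
  have hN' : (N : ℂ) ≠ 0 := by exact_mod_cast hN.ne'
  have : (a : ℂ) + ((j + (2 * N : ℕ) * k : ℤ) : ℂ) / (2 * N) =
      ((a + k : ℤ) : ℂ) + j / (2 * N) := by
    push_cast
    field_simp
    ring
  rw [thetaTerm, thetaTerm, this]

/-- With s² = Im τ/N the exponential grows like e^{πs²l²/2}, while the error factor decays like
e^{-πs²l²}, up to exponentials linear in |l|. -/
theorem summable_zwegersRTerm {N : ℕ} (hN : 0 < N) {τ : ℂ} (hτ : 0 < τ.im) (v : ℂ) :
    Summable (zwegersRTerm N τ v) := by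
  have hN' : (0 : ℝ) < N := by exact_mod_cast hN
  set s := Real.sqrt (τ.im / N) with hs
  have hs0 : 0 < s := Real.sqrt_pos.2 (by positivity)
  have hs2 : s ^ 2 = τ.im / N := Real.sq_sqrt (by positivity)
  set c := -(2 * N * (v.im / τ.im)) with hc
  refine Summable.of_norm_bounded
    ((summable_exp_quadratic (s ^ 2 * |c| + |v.im|) (by positivity : 0 < s ^ 2 / 2)).mul_left 2)
    fun l => ?_
  have hn : ‖exp (-(Real.pi * I * (l : ℂ) ^ 2 / (2 * N)) * τ - 2 * Real.pi * I * l * v)‖ =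
      Real.exp (Real.pi * (s ^ 2 / 2) * l ^ 2) * Real.exp (-(2 * Real.pi * l * (-v.im))) := by
    rw [norm_exp, ← Real.exp_add]
    congr 1
    have h1 : (-(Real.pi * I * (l : ℂ) ^ 2 / (2 * N)) * τ - 2 * Real.pi * I * l * v : ℂ) =
        ((-(Real.pi * l ^ 2 / (2 * N)) : ℝ) : ℂ) * (I * τ) +
          ((-(2 * Real.pi * l) : ℝ) : ℂ) * (I * v) := by
      push_cast
      ring
    rw [h1, add_re, re_ofReal_mul, re_ofReal_mul, hs2]
    simp only [mul_re, I_re, I_im]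
    field_simp
    ring
  have he : zwegersRTerm N τ v l =
      ((Real.sign ((l : ℝ) + 1 / 2) - zwegersE ((l - c) * s) : ℝ) : ℂ) *
      exp (-(Real.pi * I * (l : ℂ) ^ 2 / (2 * N)) * τ - 2 * Real.pi * I * l * v) := by
    rw [zwegersRTerm, hc, sub_neg_eq_add]
  rw [he, norm_mul, hn, norm_real, Real.norm_eq_abs]
  have h1 := mul_le_mul_of_nonneg_right (abs_sign_sub_zwegersE_le s c hs0 l)
    (mul_pos (Real.exp_pos (Real.pi * (s ^ 2 / 2) * l ^ 2))
      (Real.exp_pos (-(2 * Real.pi * l * (-v.im))))).le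
  refine h1.trans ?_
  have h2 := mul_le_mul_of_nonneg_left (exp_quadratic_le s c (-v.im) |c| l le_rfl)
    (Real.exp_pos (Real.pi * (s ^ 2 / 2) * l ^ 2)).le
  have h3 : Real.exp (Real.pi * (s ^ 2 / 2) * l ^ 2) *
      Real.exp (-Real.pi * (s ^ 2 * l ^ 2 - 2 * (s ^ 2 * |c| + |-v.im|) * |(l : ℝ)|)) =
      Real.exp (-Real.pi * (s ^ 2 / 2 * l ^ 2 - 2 * (s ^ 2 * |c| + |v.im|) * |(l : ℝ)|)) := by
    rw [← Real.exp_add, abs_neg v.im]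
    congr 1
    ring
  rw [h3] at h2
  linarith

/-! ### The lattice sum -/

/-- The term of index `ω = aτ + k` of the lattice sum, with `Z = z + ω`. -/
def latticeTerm (N : ℝ) (τ w z : ℂ) (p : ℤ × ℤ) : ℂ :=
  exp (-(Real.pi * N / τ.im * ‖z + p.1 * τ + p.2‖ ^ 2 : ℝ) +
      2 * Real.pi * I * (p.1 * w - (z + p.1 * τ + p.2) * (w.im / τ.im))) /
    (z + p.1 * τ + p.2)

/-- The Gaussian Kronecker–Eisenstein series
`∑ e^{-πN|z+ω|²/Im τ} e^{2πi(aw - (z+ω) Im w / Im τ)} / (z + ω)` over `ω = aτ + k`. -/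
def latticeSum (N : ℝ) (τ w z : ℂ) : ℂ := ∑' p : ℤ × ℤ, latticeTerm N τ w z p

theorem exists_norm_lattice_lower_bound {τ : ℂ} (hτ : 0 < τ.im) (z : ℂ) :
    ∃ β : ℝ, 0 < β ∧ ∀ a k : ℤ,
      β * ((a : ℝ) ^ 2 + (k : ℝ) ^ 2) - ‖z‖ ^ 2 ≤ ‖z + a * τ + k‖ ^ 2 := by
  set r := EisensteinSeries.r ⟨τ, hτ⟩ with hr
  have hr0 : 0 < r := EisensteinSeries.r_pos _
  -- One factor 1/2 comes from max(|a|, |k|)² ≥ (a² + k²)/2, the other from (x + y)² ≤ 2x² + 2y².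
  refine ⟨r ^ 2 / 4, by positivity, fun a k => ?_⟩
  have h1 : r * ‖![a, k]‖ ≤ ‖(a : ℂ) * τ + k‖ := by
    by_cases h : ![a, k] = 0
    · rw [h, norm_zero, mul_zero]
      exact norm_nonneg _
    · simpa using EisensteinSeries.r_mul_max_le ⟨τ, hτ⟩ h
  have ha : |(a : ℝ)| ≤ ‖![a, k]‖ := by
    simpa [Int.norm_eq_abs] using norm_le_pi_norm ![a, k] 0
  have hk : |(k : ℝ)| ≤ ‖![a, k]‖ := by
    simpa [Int.norm_eq_abs] using norm_le_pi_norm ![a, k] 1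
  have h2 : ‖(a : ℂ) * τ + k‖ ≤ ‖z + a * τ + k‖ + ‖z‖ := by
    have := norm_sub_le (z + a * τ + k) z
    rwa [show z + a * τ + k - z = (a : ℂ) * τ + k by ring] at this
  have ha2 : (a : ℝ) ^ 2 ≤ ‖![a, k]‖ ^ 2 := by
    rw [← sq_abs]
    gcongr
  have hk2 : (k : ℝ) ^ 2 ≤ ‖![a, k]‖ ^ 2 := by
    rw [← sq_abs]
    gcongr
  have h3 : (r * ‖![a, k]‖) ^ 2 ≤ (‖z + a * τ + k‖ + ‖z‖) ^ 2 := by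
    gcongr
    exact h1.trans h2
  have h4 := mul_le_mul_of_nonneg_left (add_le_add ha2 hk2) (sq_nonneg r)
  nlinarith [sq_nonneg (‖z + a * τ + k‖ - ‖z‖)]

theorem summable_exp_neg_norm_lattice {τ : ℂ} (hτ : 0 < τ.im) (z : ℂ) {α : ℝ} (hα : 0 < α) :
    Summable fun p : ℤ × ℤ => Real.exp (-(α * ‖z + p.1 * τ + p.2‖ ^ 2)) := by
  obtain ⟨β, hβ, hb⟩ := exists_norm_lattice_lower_bound hτ z
  have h1 : Summable fun n : ℤ => Real.exp (-(α * β * (n : ℝ) ^ 2)) := by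
    refine (summable_exp_quadratic 0 (by positivity : 0 < α * β / Real.pi)).congr fun n => ?_
    congr 1
    field_simp
    ring
  have h2 := (h1.mul_of_nonneg h1 (fun _ => (Real.exp_pos _).le)
    (fun _ => (Real.exp_pos _).le)).mul_left (Real.exp (α * ‖z‖ ^ 2))
  refine Summable.of_nonneg_of_le (fun _ => (Real.exp_pos _).le) (fun p => ?_) h2
  rw [← Real.exp_add, ← Real.exp_add]
  refine Real.exp_le_exp.2 ?_
  have := mul_le_mul_of_nonneg_left (hb p.1 p.2) hα.le
  linarith

theorem eventually_one_le_norm_lattice {τ : ℂ} (hτ : 0 < τ.im) (z : ℂ) :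
    ∀ᶠ p : ℤ × ℤ in Filter.cofinite, 1 ≤ ‖z + p.1 * τ + p.2‖ := by
  have h := (summable_exp_neg_norm_lattice hτ z one_pos).tendsto_cofinite_zero
  filter_upwards [h.eventually_lt_const (Real.exp_pos (-1))] with p hp
  have h1 := Real.exp_lt_exp.1 hp
  by_contra! h2
  have := norm_nonneg (z + p.1 * τ + p.2)
  nlinarith

theorem summable_latticeTerm {N : ℝ} (hN : 0 < N) {τ : ℂ} (hτ : 0 < τ.im) (w z : ℂ) :
    Summable (latticeTerm N τ w z) := by
  refine summable_div_of_eventually_one_le_norm ?_ (eventually_one_le_norm_lattice hτ z)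
  refine Summable.of_norm (((summable_exp_neg_norm_lattice hτ z
    (by positivity : 0 < Real.pi * N / τ.im)).mul_right
      (Real.exp (2 * Real.pi * (z.im * w.im / τ.im)))).congr fun p => ?_)
  rw [norm_exp, ← Real.exp_add]
  congr 1
  have h1 : (2 * Real.pi * I * (p.1 * w - (z + p.1 * τ + p.2) * (w.im / τ.im)) : ℂ) =
      ((2 * Real.pi : ℝ) : ℂ) * (I * (((p.1 : ℝ) : ℂ) * w -
        ((w.im / τ.im : ℝ) : ℂ) * (z + ((p.1 : ℝ) : ℂ) * τ + ((p.2 : ℝ) : ℂ)))) := by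
    push_cast
    ring
  rw [h1, add_re, neg_re, ofReal_re, re_ofReal_mul, I_mul_re, sub_im, im_ofReal_mul,
    im_ofReal_mul, add_im, add_im, im_ofReal_mul, ofReal_im]
  field_simp
  ring

/-! ### The modified numerator as a lattice sum -/

/-- The common factor `e^{2πi a N u} q^{N a²}` of the terms in row `a`. -/
def rowFactor (N : ℕ) (τ u : ℂ) (a : ℤ) : ℂ :=
  exp (2 * Real.pi * I * a * N * u) * qpow τ ((a : ℂ) ^ 2 * N)

theorem rowFactor_eq_thetaTerm (N : ℕ) (τ u : ℂ) (a : ℤ) :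
    rowFactor N τ u a = thetaTerm N τ u 0 a := by
  rw [rowFactor, thetaTerm, mul_comm]
  congr 2 <;> push_cast <;> ring

theorem zwegersRTerm_eq (N : ℕ) (τ z₁ z₂ : ℂ) (l : ℤ) :
    zwegersRTerm N τ ((z₁ - z₂) / 2) l =
      ((Real.sign ((l : ℝ) + 1 / 2) -
        zwegersE ((l - -(N * ((z₁.im - z₂.im) / τ.im))) * Real.sqrt (τ.im / N)) : ℝ) : ℂ) *
      exp (-(Real.pi * I * (l : ℂ) ^ 2 / (2 * N)) * τ - 2 * Real.pi * I * l * ((z₁ - z₂) / 2)) := by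
  have h : ((z₁ - z₂) / 2).im = (z₁.im - z₂.im) / 2 := by
    rw [show (2 : ℂ) = ((2 : ℝ) : ℂ) by norm_num, div_ofReal_im, sub_im]
  rw [zwegersRTerm, h]
  congr 5
  ring

/-- The quadratic exponents in l cancel between R and Θ, leaving e^{2πil(z₂ + aτ)}. With Θ_{-l} the
same cancellation leaves e^{-2πil(z₁ + aτ)}. -/
theorem zwegersRTerm_mul_thetaTerm {N : ℕ} (hN : 0 < N) (τ z₁ z₂ : ℂ) (l a : ℤ) :
    zwegersRTerm N τ ((z₁ - z₂) / 2) l * thetaTerm N τ (z₁ + z₂) l a =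
      rowFactor N τ (z₁ + z₂) a *
        errTerm (Real.sqrt (τ.im / N)) (-(N * ((z₁.im - z₂.im) / τ.im))) (z₂ + a * τ) l := by
  have hN' : (N : ℂ) ≠ 0 := by exact_mod_cast hN.ne'
  rw [zwegersRTerm_eq, errTerm, mul_assoc, mul_left_comm (rowFactor N τ (z₁ + z₂) a)]
  congr 1
  rw [thetaTerm, rowFactor, qpow, qpow, ← exp_add, ← exp_add, ← exp_add, ← exp_add]
  congr 1
  field_simp
  ring

theorem zwegersRTerm_mul_thetaTerm_neg {N : ℕ} (hN : 0 < N) (τ z₁ z₂ : ℂ) (l a : ℤ) :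
    zwegersRTerm N τ ((z₁ - z₂) / 2) l * thetaTerm N τ (z₁ + z₂) (-l) a =
      rowFactor N τ (z₁ + z₂) a *
        errTerm (Real.sqrt (τ.im / N)) (-(N * ((z₁.im - z₂.im) / τ.im))) (-(z₁ + a * τ)) l := by
  have hN' : (N : ℂ) ≠ 0 := by exact_mod_cast hN.ne'
  rw [zwegersRTerm_eq, errTerm, mul_assoc, mul_left_comm (rowFactor N τ (z₁ + z₂) a)]
  congr 1
  rw [thetaTerm, rowFactor, qpow, qpow, ← exp_add, ← exp_add, ← exp_add, ← exp_add]
  congr 1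
  push_cast
  field_simp
  ring

theorem ofReal_norm_sq (Z : ℂ) : ((‖Z‖ ^ 2 : ℝ) : ℂ) = Z ^ 2 - 2 * I * Z * Z.im := by
  have h1 : (Z - 2 * I * Z.im : ℂ) = (starRingEnd ℂ) Z := by
    apply Complex.ext
    · simp
    · simp
      ring
  rw [← normSq_eq_norm_sq, ← mul_conj, ← h1]
  ring

theorem rowFactor_mul_gaussTerm {N : ℕ} (hN : 0 < N) {τ : ℂ} (hτ : 0 < τ.im) (z₁ z₂ : ℂ)
    (a k : ℤ) :
    rowFactor N τ (z₁ + z₂) a *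
        (gaussTerm (Real.sqrt (τ.im / N)) (N * ((z₁.im - z₂.im) / τ.im)) (z₁ + a * τ) k /
          (z₁ + a * τ + k)) =
      latticeTerm N τ (N * z₂) z₁ (a, k) := by
  have hN' : (N : ℂ) ≠ 0 := by exact_mod_cast hN.ne'
  have hτ' : (τ.im : ℂ) ≠ 0 := by exact_mod_cast hτ.ne'
  have hs : ((Real.sqrt (τ.im / N) : ℝ) : ℂ) ^ 2 = τ.im / N := by
    rw [← ofReal_pow, Real.sq_sqrt (by positivity)]
    push_cast
    rfl
  have him : (z₁ + a * τ + k).im = z₁.im + a * τ.im := by simp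
  have him2 : ((N : ℂ) * z₂).im = N * z₂.im := by simp
  rw [← mul_div_assoc, latticeTerm]
  congr 1
  rw [rowFactor, qpow, gaussTerm, ← exp_add, ← exp_add, hs, exp_eq_exp_iff_exists_int]
  -- The two exponents agree only up to the integer multiple -Nak of 2πi.
  refine ⟨-(N * a * k), ?_⟩
  simp only
  rw [ofReal_mul (Real.pi * N / τ.im), ofReal_norm_sq, him, him2]
  push_cast
  field_simp
  ring

theorem summable_rowFactor {N : ℕ} (hN : 0 < N) {τ : ℂ} (hτ : 0 < τ.im) (u : ℂ) :
    Summable (rowFactor N τ u) :=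
  (summable_thetaTerm hN hτ u 0).congr fun a => (rowFactor_eq_thetaTerm N τ u a).symm

theorem summable_rowFactor_mul_tsum_errTerm {N : ℕ} (hN : 0 < N) {τ : ℂ} (hτ : 0 < τ.im)
    (z₁ z₂ : ℂ) :
    Summable fun a : ℤ => rowFactor N τ (z₁ + z₂) a *
      ∑' l, errTerm (Real.sqrt (τ.im / N)) (-(N * ((z₁.im - z₂.im) / τ.im))) (z₂ + a * τ) l := by
  have : NeZero (2 * N) := ⟨by omega⟩
  have h := (summable_mul_of_residue (2 * N) (summable_zwegersRTerm hN hτ ((z₁ - z₂) / 2))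
    (g := thetaTerm N τ (z₁ + z₂)) (summable_thetaTerm hN hτ (z₁ + z₂))
    fun l k => ⟨k, fun a => thetaTerm_add_mul hN τ _ l k a⟩).prod_symm.prod
  refine h.congr fun a => ?_
  rw [← tsum_mul_left]
  exact tsum_congr fun l => zwegersRTerm_mul_thetaTerm hN τ z₁ z₂ l a

theorem exists_thetaTerm_neg_shift {N : ℕ} (hN : 0 < N) (τ u : ℂ) (l k : ℤ) :
    ∃ e : ℤ, ∀ a, thetaTerm N τ u (-(l + (2 * N : ℕ) * k)) a = thetaTerm N τ u (-l) (a + e) := by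
  refine ⟨-k, fun a => ?_⟩
  rw [← thetaTerm_add_mul hN]
  congr 1
  ring

theorem summable_rowFactor_mul_tsum_errTerm_neg {N : ℕ} (hN : 0 < N) {τ : ℂ} (hτ : 0 < τ.im)
    (z₁ z₂ : ℂ) :
    Summable fun a : ℤ => rowFactor N τ (z₁ + z₂) a *
      ∑' l, errTerm (Real.sqrt (τ.im / N)) (-(N * ((z₁.im - z₂.im) / τ.im))) (-(z₁ + a * τ)) l := by
  have : NeZero (2 * N) := ⟨by omega⟩
  have h := (summable_mul_of_residue (2 * N) (summable_zwegersRTerm hN hτ ((z₁ - z₂) / 2))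
    (g := fun l => thetaTerm N τ (z₁ + z₂) (-l)) (fun l => summable_thetaTerm hN hτ (z₁ + z₂) (-l))
    (exists_thetaTerm_neg_shift hN τ _)).prod_symm.prod
  refine h.congr fun a => ?_
  rw [← tsum_mul_left]
  exact tsum_congr fun l => zwegersRTerm_mul_thetaTerm_neg hN τ z₁ z₂ l a

theorem PhiAdd_eq (m : ℕ) {τ : ℂ} (hτ : 0 < τ.im) (z₁ z₂ t : ℂ) :
    PhiAdd m τ z₁ z₂ t = exp (2 * Real.pi * I * (m + 1) * t) *
      ((∑' a : ℤ, 1 / 2 * (rowFactor (m + 1) τ (z₁ + z₂) a *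
        ∑' l, errTerm (Real.sqrt (τ.im / (m + 1 : ℕ)))
          (-((m + 1 : ℕ) * ((z₁.im - z₂.im) / τ.im))) (-(z₁ + a * τ)) l)) -
      ∑' a : ℤ, 1 / 2 * (rowFactor (m + 1) τ (z₁ + z₂) a *
        ∑' l, errTerm (Real.sqrt (τ.im / (m + 1 : ℕ)))
          (-((m + 1 : ℕ) * ((z₁.im - z₂.im) / τ.im))) (z₂ + a * τ) l)) := by
  have hN : 0 < m + 1 := m.succ_pos
  have : NeZero (2 * (m + 1)) := ⟨by omega⟩
  have hR : ∀ j : ℕ, zwegersR (m + 1) j τ ((z₁ - z₂) / 2) =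
      ∑' k : ℤ, zwegersRTerm (m + 1) τ ((z₁ - z₂) / 2) (j + (2 * (m + 1) : ℕ) * k) := by
    intro j
    rw [zwegersR]
    refine tsum_congr fun k => ?_
    congr 1
  have h1 := sum_tsum_mul_tsum_residue (2 * (m + 1))
    (summable_zwegersRTerm hN hτ ((z₁ - z₂) / 2))
    (g := thetaTerm (m + 1) τ (z₁ + z₂)) (summable_thetaTerm hN hτ (z₁ + z₂))
    fun l k => ⟨k, fun a => thetaTerm_add_mul hN τ _ l k a⟩
  have h2 := sum_tsum_mul_tsum_residue (2 * (m + 1))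
    (summable_zwegersRTerm hN hτ ((z₁ - z₂) / 2))
    (g := fun l => thetaTerm (m + 1) τ (z₁ + z₂) (-l))
    (fun l => summable_thetaTerm hN hτ (z₁ + z₂) (-l)) (exists_thetaTerm_neg_shift hN τ _)
  simp_rw [zwegersRTerm_mul_thetaTerm hN τ z₁ z₂, tsum_mul_left, ← hR] at h1
  simp_rw [zwegersRTerm_mul_thetaTerm_neg hN τ z₁ z₂, tsum_mul_left, ← hR] at h2
  have h3 : PhiAdd m τ z₁ z₂ t = -(1 / 2) * exp (2 * Real.pi * I * (m + 1) * t) *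
      ∑ j ∈ Finset.range (2 * (m + 1)), zwegersR (m + 1) j τ ((z₁ - z₂) / 2) *
        (∑' a, thetaTerm (m + 1) τ (z₁ + z₂) j a -
          ∑' a, thetaTerm (m + 1) τ (z₁ + z₂) (-(j : ℤ)) a) := rfl
  simp_rw [h3, mul_sub, Finset.sum_sub_distrib]
  rw [tsum_mul_left, tsum_mul_left, ← h1, ← h2]
  ring

theorem Phi_eq (m : ℕ) (τ z₁ z₂ t : ℂ)
    (hA : Summable fun a : ℤ => rowFactor (m + 1) τ (z₁ + z₂) a *
      (1 / (1 - exp (2 * Real.pi * I * (z₁ + a * τ)))))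
    (hB : Summable fun a : ℤ => rowFactor (m + 1) τ (z₁ + z₂) a *
      (1 / (1 - exp (-(2 * Real.pi * I * (z₂ + a * τ)))))) :
    Phi m τ z₁ z₂ t = exp (2 * Real.pi * I * (m + 1) * t) *
      ((∑' a : ℤ, rowFactor (m + 1) τ (z₁ + z₂) a *
        (1 / (1 - exp (2 * Real.pi * I * (z₁ + a * τ))))) -
      ∑' a : ℤ, rowFactor (m + 1) τ (z₁ + z₂) a *
        (1 / (1 - exp (-(2 * Real.pi * I * (z₂ + a * τ)))))) := by
  have hB' : Summable fun a : ℤ => rowFactor (m + 1) τ (z₁ + z₂) (Equiv.neg ℤ a) *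
      (1 / (1 - exp (-(2 * Real.pi * I * (z₂ + ((Equiv.neg ℤ a : ℤ) : ℂ) * τ))))) :=
    (Equiv.summable_iff (Equiv.neg ℤ)).2 hB
  -- Replacing j by -j in the second half of Φ gives both halves the same row factor.
  rw [Phi, ← (Equiv.neg ℤ).tsum_eq (fun a : ℤ => rowFactor (m + 1) τ (z₁ + z₂) a *
        (1 / (1 - exp (-(2 * Real.pi * I * (z₂ + a * τ)))))), ← hA.tsum_sub hB']
  congr 1
  refine tsum_congr fun j => ?_
  have h1 : exp (2 * Real.pi * I * z₁) * qpow τ j = exp (2 * Real.pi * I * (z₁ + j * τ)) := by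
    rw [qpow, ← exp_add]
    congr 1
    ring
  have h2 : exp (-(2 * Real.pi * I * z₂)) * qpow τ j =
      exp (-(2 * Real.pi * I * (z₂ + ((Equiv.neg ℤ j : ℤ) : ℂ) * τ))) := by
    rw [qpow, ← exp_add, Equiv.neg_apply]
    congr 1
    push_cast
    ring
  rw [h1, h2]
  simp only [rowFactor, mul_one_div, Equiv.neg_apply]
  push_cast
  congr 3
  · congr 1
    ring
  · rw [neg_sq]

theorem add_mul_add_ne_zero {τ z : ℂ} (hz : ∀ a b : ℤ, z ≠ a + b * τ) (a k : ℤ) :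
    z + a * τ + k ≠ 0 := by
  intro h
  refine hz (-k) (-a) ?_
  push_cast
  linear_combination h

theorem PhiTilde_eq (m : ℕ) {τ : ℂ} (hτ : 0 < τ.im) {z₁ z₂ : ℂ}
    (hz₁ : ∀ a b : ℤ, z₁ ≠ a + b * τ) (hz₂ : ∀ a b : ℤ, z₂ ≠ a + b * τ) (t : ℂ) :
    PhiTilde m τ z₁ z₂ t = exp (2 * Real.pi * I * (m + 1) * t) * (I / (2 * Real.pi)) *
      (latticeSum (m + 1) τ ((m + 1) * z₂) z₁ + latticeSum (m + 1) τ ((m + 1) * z₁) z₂) := by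
  have hN : 0 < m + 1 := m.succ_pos
  have hNr : (0 : ℝ) < (m + 1 : ℕ) := by exact_mod_cast hN
  set s := Real.sqrt (τ.im / (m + 1 : ℕ)) with hs
  have hs0 : 0 < s := Real.sqrt_pos.2 (by positivity)
  set c := ((m + 1 : ℕ) : ℝ) * ((z₁.im - z₂.im) / τ.im) with hc
  set T := rowFactor (m + 1) τ (z₁ + z₂) with hT
  have hTs : Summable T := summable_rowFactor hN hτ _
  have hL₁ := summable_latticeTerm hNr hτ ((m + 1 : ℕ) * z₂) z₁
  have hL₂ := summable_latticeTerm hNr hτ ((m + 1 : ℕ) * z₁) z₂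
  have hU := (summable_rowFactor_mul_tsum_errTerm_neg hN hτ z₁ z₂).mul_left (1 / 2)
  have hV := (summable_rowFactor_mul_tsum_errTerm hN hτ z₁ z₂).mul_left (1 / 2)
  rw [← hs, ← hc, ← hT] at hU hV
  -- In `hA` minus `hB` the terms `T a` cancel, the lattice rows add up, and the error sums cancel
  -- against Φ_add. The two formulas also give the summability required by `Phi_eq`.
  have hA : ∀ a : ℤ, T a * (1 / (1 - exp (2 * Real.pi * I * (z₁ + a * τ)))) =
      T a + I / (2 * Real.pi) * (∑' k, latticeTerm (m + 1 : ℕ) τ ((m + 1 : ℕ) * z₂) z₁ (a, k)) -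
        1 / 2 * (T a * ∑' l, errTerm s (-c) (-(z₁ + a * τ)) l) := by
    intro a
    have h := one_div_add_tsum_errTerm_neg hs0 c (add_mul_add_ne_zero hz₁ a)
    simp_rw [← rowFactor_mul_gaussTerm hN hτ, tsum_mul_left]
    rw [← hT, ← hs, ← hc]
    linear_combination T a * h
  have hB : ∀ a : ℤ, T a * (1 / (1 - exp (-(2 * Real.pi * I * (z₂ + a * τ))))) =
      T a - I / (2 * Real.pi) * (∑' k, latticeTerm (m + 1 : ℕ) τ ((m + 1 : ℕ) * z₁) z₂ (a, k)) -
        1 / 2 * (T a * ∑' l, errTerm s (-c) (z₂ + a * τ) l) := by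
    intro a
    have h := neg_one_div_sub_tsum_errTerm hs0 (-c) (add_mul_add_ne_zero hz₂ a)
    simp_rw [← rowFactor_mul_gaussTerm hN hτ, tsum_mul_left]
    have hc' : ((m + 1 : ℕ) : ℝ) * ((z₂.im - z₁.im) / τ.im) = -c := by
      rw [hc]
      ring
    rw [add_comm z₂ z₁, ← hT, ← hs, hc']
    linear_combination (-T a) * h
  have hl₁ := hL₁.prod.mul_left (I / (2 * Real.pi))
  have hl₂ := hL₂.prod.mul_left (I / (2 * Real.pi))
  rw [PhiTilde, PhiAdd_eq m hτ, Phi_eq, ← hs, ← hc, ← hT]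
  · simp_rw [hA, hB]
    rw [(hTs.add hl₁).tsum_sub hU, hTs.tsum_add hl₁, (hTs.sub hl₂).tsum_sub hV, hTs.tsum_sub hl₂,
      tsum_mul_left (a := I / (2 * Real.pi)), tsum_mul_left (a := I / (2 * Real.pi)),
      ← hL₁.tsum_prod, ← hL₂.tsum_prod, latticeSum, latticeSum]
    push_cast
    ring
  · rw [← hT]
    simp_rw [hA]
    exact (hTs.add hl₁).sub hU
  · rw [← hT]
    simp_rw [hB]
    exact (hTs.sub hl₂).sub hV

/-! ### Modular transformations of the lattice sum -/

theorem neg_one_div_im (τ : ℂ) : (-1 / τ).im = τ.im / normSq τ := by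
  rw [div_im]
  simp [neg_div]

/-- Dividing the lattice by τ leaves |Z|²/Im τ unchanged, and the phase changes by e^{2πiwz/τ}, the
same for every lattice point. -/
theorem latticeSum_neg_one_div (N : ℝ) {τ : ℂ} (hτ : 0 < τ.im) (w z : ℂ) :
    latticeSum N (-1 / τ) (w / τ) (z / τ) =
      τ * exp (2 * Real.pi * I * (w * z / τ)) * latticeSum N τ w z := by
  have hτ0 : τ ≠ 0 := by
    rintro rfl
    simp at hτ
  have hi : (τ.im : ℂ) ≠ 0 := by exact_mod_cast hτ.ne'
  have hn : normSq τ ≠ 0 := (normSq_pos.2 hτ0).ne'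
  have hnC : (normSq τ : ℂ) ≠ 0 := by exact_mod_cast hn
  -- This is (a, k) ↦ (k, -a), since a(-1/τ) + k = (kτ - a)/τ.
  set e : ℤ × ℤ ≃ ℤ × ℤ := (Equiv.prodComm ℤ ℤ).trans ((Equiv.refl ℤ).prodCongr (Equiv.neg ℤ))
    with he
  rw [latticeSum, latticeSum, ← e.tsum_eq (latticeTerm N τ w z), ← tsum_mul_left]
  refine tsum_congr fun p => ?_
  obtain ⟨a, k⟩ := p
  have hep : e (a, k) = (k, -a) := rfl
  rw [hep, latticeTerm, latticeTerm]
  simp only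
  have hZ : z / τ + a * (-1 / τ) + k = (z + k * τ + ((-a : ℤ) : ℂ)) / τ := by
    push_cast
    field_simp
    ring
  rw [hZ]
  set Z := z + k * τ + ((-a : ℤ) : ℂ) with hZd
  have him := neg_one_div_im τ
  have hwi : (w / τ).im = (w.im * τ.re - w.re * τ.im) / normSq τ := by
    rw [div_im]
    ring
  have hnorm : Real.pi * N / (-1 / τ).im * ‖Z / τ‖ ^ 2 = Real.pi * N / τ.im * ‖Z‖ ^ 2 := by
    rw [him, norm_div, div_pow, ← normSq_eq_norm_sq τ]
    field_simp
  rw [hnorm, div_div_eq_mul_div, mul_comm _ τ, mul_div_assoc τ, mul_assoc τ,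
    ← mul_div_assoc (exp _), ← exp_add]
  -- The terms Im w · Im τ · i cancel, so Re τ and Re w may be replaced by τ and w.
  have hre : (((w.im * τ.re - w.re * τ.im) / normSq τ : ℝ) : ℂ) =
      (w.im * τ - w * τ.im) / normSq τ := by
    have hw : w = w.re + w.im * I := (re_add_im w).symm
    have ht : τ = τ.re + τ.im * I := (re_add_im τ).symm
    push_cast
    congr 1
    linear_combination (-(w.im : ℂ)) * ht + τ.im * hw
  congr 3
  rw [him, hwi, hre, hZd]
  push_cast
  field_simp
  ring

/-- The shift by rτ moves row a to row r + Ma of ℤτ + ℤ; the shift of z₂ by στ, with the prefactor,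
leaves only the character e^{-2πiNσk/M}. -/
theorem latticeTerm_twist (N M : ℕ) [NeZero M] {τ : ℂ} (hτ : 0 < τ.im) (z₁ z₂ : ℂ)
    (r σ a k : ℤ) :
    qpow τ (N / M * r * σ) * exp (2 * Real.pi * I * N / M * (σ * z₁ + r * z₂)) *
        latticeTerm N (M * τ) (N * (z₂ + σ * τ)) (z₁ + r * τ) (a, k) =
      latticeTerm (N / M) τ (N / M * z₂) z₁ (r + M * a, k) *
        ZMod.stdAddChar ((σ : ZMod M) * ((-(N * k) : ℤ) : ZMod M)) := by
  have hM : (M : ℂ) ≠ 0 := by exact_mod_cast NeZero.ne M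
  have hMr : (M : ℝ) ≠ 0 := by exact_mod_cast NeZero.ne M
  have hi : (τ.im : ℂ) ≠ 0 := by exact_mod_cast hτ.ne'
  have hZ : z₁ + r * τ + a * (M * τ) + k = z₁ + ((r + M * a : ℤ) : ℂ) * τ + k := by
    push_cast
    ring
  have h1 : ((M : ℂ) * τ).im = M * τ.im := by simp
  have h2 : ((N : ℂ) * (z₂ + σ * τ)).im = N * (z₂.im + σ * τ.im) := by simp
  have h3 : ((N : ℂ) / M * z₂).im = N / M * z₂.im := by
    rw [show (N : ℂ) / M = ((N / M : ℝ) : ℂ) by push_cast; rfl, im_ofReal_mul]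
  rw [← Int.cast_mul, ZMod.stdAddChar_coe, latticeTerm, latticeTerm]
  simp only
  rw [hZ, h1, h2, h3, ← mul_div_assoc (_ * exp _), div_mul_eq_mul_div (exp _), qpow,
    ← exp_add, ← exp_add, ← exp_add]
  congr 2
  have h4 : Real.pi * N / (M * τ.im) = Real.pi * (N / M) / τ.im := by
    field_simp
  rw [h4]
  push_cast
  field_simp
  ring

theorem twist_mul_latticeSum (N M : ℕ) [NeZero M] {τ : ℂ} (hτ : 0 < τ.im) (z₁ z₂ : ℂ)
    (r σ : ℤ) :
    qpow τ (N / M * r * σ) * exp (2 * Real.pi * I * N / M * (σ * z₁ + r * z₂)) *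
        latticeSum N (M * τ) (N * (z₂ + σ * τ)) (z₁ + r * τ) =
      ∑' p : ℤ × ℤ, if (p.1 : ZMod M) = r then latticeTerm (N / M) τ (N / M * z₂) z₁ p *
        ZMod.stdAddChar ((σ : ZMod M) * ((-(N * p.2) : ℤ) : ZMod M)) else 0 := by
  have hM : (M : ℤ) ≠ 0 := by exact_mod_cast NeZero.ne M
  have hinj : Function.Injective fun p : ℤ × ℤ => (r + M * p.1, p.2) := by
    rintro ⟨a, k⟩ ⟨a', k'⟩ h
    simp only [Prod.mk.injEq, add_right_inj] at h
    exact Prod.ext (mul_left_cancel₀ hM h.1) h.2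
  rw [latticeSum, ← tsum_mul_left]
  symm
  refine (hinj.tsum_eq ?_).symm.trans (tsum_congr fun p => ?_)
  · rintro ⟨A, k⟩ h
    have hA : (A : ZMod M) = r := by
      by_contra hne
      exact h (if_neg hne)
    obtain ⟨a, ha⟩ := (ZMod.intCast_eq_intCast_iff_dvd_sub r A M).1 hA.symm
    exact ⟨(a, k), by simp only [Prod.mk.injEq, and_true]; omega⟩
  · rw [latticeTerm_twist N M hτ, if_pos (by simp)]

theorem latticeTerm_div (N M : ℕ) [NeZero M] {τ : ℂ} (hτ : 0 < τ.im) (z₁ z₂ : ℂ) (a k : ℤ) :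
    latticeTerm N (τ / M) (N * (z₂ / M)) (z₁ / M) (a, k) =
      latticeTerm (N / M) τ (N / M * z₂) z₁ (a, M * k) * M := by
  have hM : (M : ℂ) ≠ 0 := by exact_mod_cast NeZero.ne M
  have hMr : (M : ℝ) ≠ 0 := by exact_mod_cast NeZero.ne M
  have hi : (τ.im : ℂ) ≠ 0 := by exact_mod_cast hτ.ne'
  have hZ : z₁ / M + a * (τ / M) + k = (z₁ + a * τ + ((M * k : ℤ) : ℂ)) / M := by
    push_cast
    field_simp
  have h1 : (τ / M : ℂ).im = τ.im / M := by
    rw [← ofReal_natCast, div_ofReal_im]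
  have h2 : (N * (z₂ / M) : ℂ).im = N / M * z₂.im := by
    rw [show (N * (z₂ / M) : ℂ) = ((N / M : ℝ) : ℂ) * z₂ by push_cast; ring, im_ofReal_mul]
  have h3 : ((N : ℂ) / M * z₂).im = N / M * z₂.im := by
    rw [show (N : ℂ) / M = ((N / M : ℝ) : ℂ) by push_cast; rfl, im_ofReal_mul]
  rw [latticeTerm, latticeTerm]
  simp only
  rw [hZ, h1, h2, h3, div_div_eq_mul_div (exp _), div_mul_eq_mul_div (exp _)]
  congr 3
  have h4 : ∀ Z : ℂ, Real.pi * N / (τ.im / M) * ‖Z / M‖ ^ 2 =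
      Real.pi * (N / M) / τ.im * ‖Z‖ ^ 2 := by
    intro Z
    rw [norm_div, norm_natCast]
    field_simp
  rw [h4]
  push_cast
  field_simp

theorem sum_twist_mul_latticeSum {N : ℕ} (hN : 0 < N) (M : ℕ) [NeZero M] (hNM : Nat.Coprime N M)
    {τ : ℂ} (hτ : 0 < τ.im) (z₁ z₂ : ℂ) (r s : ZMod M → ZMod M → ℤ)
    (hr : ∀ j k : ZMod M, ((r j k : ℤ) : ZMod M) = j)
    (hs : ∀ j k : ZMod M, ((s j k : ℤ) : ZMod M) = k) :
    ∑ j : ZMod M, ∑ k : ZMod M,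
      qpow τ (N / M * r j k * s j k) *
        exp (2 * Real.pi * I * N / M * (s j k * z₁ + r j k * z₂)) *
        latticeSum N (M * τ) (N * (z₂ + s j k * τ)) (z₁ + r j k * τ) =
      latticeSum N (τ / M) (N * (z₂ / M)) (z₁ / M) := by
  have hM : (M : ℤ) ≠ 0 := by exact_mod_cast NeZero.ne M
  have hM0 : 0 < M := NeZero.pos M
  simp_rw [twist_mul_latticeSum N M hτ, hr, hs]
  have hL := summable_latticeTerm (N := N / M) (by positivity) hτ (N / M * z₂) z₁
  have hsum : ∀ j k : ZMod M, Summable fun p : ℤ × ℤ =>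
      if (p.1 : ZMod M) = j then latticeTerm (N / M) τ (N / M * z₂) z₁ p *
        ZMod.stdAddChar (k * ((-(N * p.2) : ℤ) : ZMod M)) else 0 := by
    intro j k
    refine Summable.of_norm_bounded hL.norm fun p => ?_
    split_ifs
    · rw [norm_mul, AddChar.norm_apply, mul_one]
    · rw [norm_zero]
      exact norm_nonneg _
  simp_rw [← Summable.tsum_finsetSum fun k _ => hsum _ k]
  rw [← Summable.tsum_finsetSum fun j _ => summable_sum fun k _ => hsum j k]
  have hrow : ∀ p : ℤ × ℤ, (∑ j : ZMod M, ∑ k : ZMod M,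
      if (p.1 : ZMod M) = j then latticeTerm (N / M) τ (N / M * z₂) z₁ p *
        ZMod.stdAddChar (k * ((-(N * p.2) : ℤ) : ZMod M)) else 0) =
      if (M : ℤ) ∣ p.2 then latticeTerm (N / M) τ (N / M * z₂) z₁ p * M else 0 := by
    intro p
    rw [Finset.sum_comm]
    simp_rw [Finset.sum_ite_eq, Finset.mem_univ, if_true]
    -- Orthogonality of characters gives M if M ∣ Nk and 0 otherwise; coprimality turns this into M
    -- ∣ k.
    rw [← Finset.mul_sum, AddChar.sum_mulShift _ (ZMod.isPrimitive_stdAddChar M), ZMod.card]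
    have hiff : (((-(N * p.2) : ℤ) : ZMod M) = 0) ↔ (M : ℤ) ∣ p.2 := by
      rw [ZMod.intCast_zmod_eq_zero_iff_dvd, dvd_neg]
      exact ⟨fun h => (Nat.isCoprime_iff_coprime.2 hNM.symm).dvd_of_dvd_mul_left h,
        fun h => h.mul_left _⟩
    by_cases h : (M : ℤ) ∣ p.2
    · rw [if_pos (hiff.2 h), if_pos h]
    · rw [if_neg (mt hiff.1 h), if_neg h, Nat.cast_zero, mul_zero]
  simp_rw [hrow]
  have hinj : Function.Injective fun p : ℤ × ℤ => (p.1, (M : ℤ) * p.2) := by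
    rintro ⟨a, k⟩ ⟨a', k'⟩ h
    simp only [Prod.mk.injEq] at h
    exact Prod.ext h.1 (mul_left_cancel₀ hM h.2)
  refine (hinj.tsum_eq ?_).symm.trans (tsum_congr fun p => ?_)
  · rintro ⟨a, k⟩ h
    have hk : (M : ℤ) ∣ k := by
      by_contra hne
      exact h (if_neg hne)
    obtain ⟨k', rfl⟩ := hk
    exact ⟨(a, k'), rfl⟩
  · rw [if_pos (dvd_mul_right _ _)]
    exact (latticeTerm_div N M hτ z₁ z₂ p.1 p.2).symm

/-! ### Modular transformations of the modified numerator -/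

/-- Both series acquire the same factor e^{2πi(m+1)z₁z₂/τ}, since w z = (m+1)z₁z₂ in each; the shift
of t cancels it. -/
theorem PhiTilde_neg_one_div (m : ℕ) {τ : ℂ} (hτ : 0 < τ.im) {z₁ z₂ : ℂ}
    (hz₁ : ∀ a b : ℤ, z₁ ≠ a + b * τ) (hz₂ : ∀ a b : ℤ, z₂ ≠ a + b * τ) (t : ℂ) :
    PhiTilde m (-1 / τ) (z₁ / τ) (z₂ / τ) (t - z₁ * z₂ / τ) = τ * PhiTilde m τ z₁ z₂ t := by
  have hτ0 : τ ≠ 0 := by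
    rintro rfl
    simp at hτ
  have him : 0 < (-1 / τ).im := by
    rw [neg_one_div_im]
    exact div_pos hτ (normSq_pos.2 hτ0)
  have hz : ∀ z : ℂ, (∀ a b : ℤ, z ≠ a + b * τ) → ∀ a b : ℤ, z / τ ≠ a + b * (-1 / τ) := by
    intro z hz a b h
    refine hz (-b) a ?_
    field_simp at h
    push_cast
    linear_combination h
  rw [PhiTilde_eq m him (hz z₁ hz₁) (hz z₂ hz₂), PhiTilde_eq m hτ hz₁ hz₂,
    ← mul_div_assoc _ z₁, ← mul_div_assoc _ z₂, latticeSum_neg_one_div _ hτ,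
    latticeSum_neg_one_div _ hτ]
  have h1 : exp (2 * Real.pi * I * (m + 1) * (t - z₁ * z₂ / τ)) *
      exp (2 * Real.pi * I * ((m + 1) * z₂ * z₁ / τ)) = exp (2 * Real.pi * I * (m + 1) * t) := by
    rw [← exp_add]
    congr 1
    ring
  rw [show ((m : ℂ) + 1) * z₁ * z₂ / τ = (m + 1) * z₂ * z₁ / τ by ring, ← h1]
  ring

theorem PhiTilde_div (M m : ℕ) [NeZero M] (hM : Nat.Coprime (m + 1) M) {τ z₁ z₂ : ℂ} (t : ℂ)
    (hτ : 0 < τ.im) (hz₁ : ∀ a b : ℤ, z₁ ≠ a + b * τ) (hz₂ : ∀ a b : ℤ, z₂ ≠ a + b * τ)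
    (hτM : 0 < (τ / M).im) (hz₁M : ∀ a b : ℤ, z₁ / M ≠ a + b * (τ / M))
    (hz₂M : ∀ a b : ℤ, z₂ / M ≠ a + b * (τ / M))
    (r s : ZMod M → ZMod M → ℤ)
    (hr : ∀ j k : ZMod M, ((r j k : ℤ) : ZMod M) = j)
    (hs : ∀ j k : ZMod M, ((s j k : ℤ) : ZMod M) = k) :
    PhiTilde m (τ / M) (z₁ / M) (z₂ / M) t =
      ∑ j : ZMod M, ∑ k : ZMod M, modSummand M m τ z₁ z₂ t (r j k) (s j k) := by
  have him : 0 < (M * τ : ℂ).im := by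
    have : (M * τ : ℂ).im = M * τ.im := by simp
    have hM0 := NeZero.pos M
    rw [this]
    positivity
  have hshift : ∀ z : ℂ, (∀ a b : ℤ, z ≠ a + b * τ) → ∀ j a b : ℤ,
      z + j * τ ≠ a + b * (M * τ) := by
    intro z hz j a b h
    refine hz a (b * M - j) ?_
    push_cast
    linear_combination h
  have h1 := sum_twist_mul_latticeSum m.succ_pos M hM hτ z₁ z₂ r s hr hs
  -- The second series is the first with (z₁, r) and (z₂, s) exchanged.
  have h2 := sum_twist_mul_latticeSum m.succ_pos M hM hτ z₂ z₁ (fun k j => s j k)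
    (fun k j => r j k) (fun k j => hs j k) (fun k j => hr j k)
  rw [Finset.sum_comm] at h2
  push_cast at h1 h2
  rw [PhiTilde_eq m hτM hz₁M hz₂M, ← h1, ← h2, ← Finset.sum_add_distrib, Finset.mul_sum]
  refine Finset.sum_congr rfl fun j _ => ?_
  rw [← Finset.sum_add_distrib, Finset.mul_sum]
  refine Finset.sum_congr rfl fun k _ => ?_
  rw [modSummand, PhiTilde_eq m him (hshift z₁ hz₁ _) (hshift z₂ hz₂ _),
    show ((m : ℂ) + 1) / M * s j k * r j k = (m + 1) / M * r j k * s j k by ring,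
    add_comm ((r j k : ℂ) * z₂)]
  ring

end SL21

end

/-- The sum over `j, k ∈ ℤ/Mℤ` is taken over an arbitrary choice of integer representatives
`(r j k, s j k)` of the pairs `(j, k)`, so that its independence of the choice is part of the
claim. -/
theorem theorem6p5 (M m : ℕ) [NeZero M] (hM : 0 < m → Nat.gcd M (2 * m + 2) = 1)
    (τ z₁ z₂ t : ℂ) (hτ : 0 < τ.im)
    (hz₁ : ∀ a b : ℤ, z₁ ≠ a + b * τ) (hz₂ : ∀ a b : ℤ, z₂ ≠ a + b * τ)
    (r s : ZMod M → ZMod M → ℤ)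
    (hr : ∀ j k : ZMod M, ((r j k : ℤ) : ZMod M) = j)
    (hs : ∀ j k : ZMod M, ((s j k : ℤ) : ZMod M) = k) :
    SL21.PhiTilde m (-M / τ) (z₁ / τ) (z₂ / τ) (t - z₁ * z₂ / (τ * M)) =
        τ / M * ∑ j : ZMod M, ∑ k : ZMod M, SL21.modSummand M m τ z₁ z₂ t (r j k) (s j k) ∧
      SL21.PhiTilde m (τ / M) (z₁ / M) (z₂ / M) t =
        ∑ j : ZMod M, ∑ k : ZMod M, SL21.modSummand M m τ z₁ z₂ t (r j k) (s j k) := by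
  have hM0 : (M : ℂ) ≠ 0 := by exact_mod_cast NeZero.ne M
  have hτ0 : τ ≠ 0 := by
    rintro rfl
    simp at hτ
  have hcop : Nat.Coprime (m + 1) M := by
    rcases Nat.eq_zero_or_pos m with rfl | hm
    · simp
    · exact (Nat.Coprime.coprime_dvd_right ⟨2, by ring⟩ (hM hm)).symm
  have hτM : 0 < (τ / M).im := by
    rw [← ofReal_natCast, div_ofReal_im]
    have := NeZero.pos M
    positivity
  have hz : ∀ z : ℂ, (∀ a b : ℤ, z ≠ a + b * τ) → ∀ a b : ℤ, z / M ≠ a + b * (τ / M) := by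
    intro z hz a b h
    refine hz (M * a) b ?_
    field_simp at h
    push_cast
    linear_combination h
  have hb := SL21.PhiTilde_div M m hcop t hτ hz₁ hz₂ hτM (hz z₁ hz₁) (hz z₂ hz₂) r s hr hs
  refine ⟨?_, hb⟩
  -- The inversion is applied at (τ/M, z₁/M, z₂/M): -1/(τ/M) = -M/τ, and the shift of t is
  -- z₁z₂/(τM).
  rw [← hb, ← SL21.PhiTilde_neg_one_div m hτM (hz z₁ hz₁) (hz z₂ hz₂)]
  congr 1 <;> field_simp
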